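/- **Theorem (completeness of the W-method for deterministic nominal automata).** Let $\mathbb A$ be a countable set of atoms and let $\mathrm{Perm}(\mathbb A)$ be the group of finite permutations of $\mathbb A$. A nominal set is a $\mathrm{Perm}(\mathbb A)$-set in which every element has a finite support; it is orbit-finite if it has finitely many orbits. Let $\Sigma$ be an orbit-finite nominal set (the alphabet); the set $\Sigma^*$ of words carries the pointwise action, and $\Sigma^{\le k}$ is the set of words of length at most $k$. A nominal automaton over $\Sigma$ is a tuple $\mathcal A=(Q,q_0,\delta,F)$, where $Q$ is a nominal set, $q_0\in Q$ is an equivariant element, $\delta\colon Q\times\Sigma\to Q$ is an equivariant map and $F\subseteq Q$ is an equivariant subset; it is a deterministic nominal automaton (DNA) if $Q$ is orbit-finite. Let $\delta^*\colon Q\times\Sigma^*\to Q$ be the extension of $\delta$ to words, let $L_{\mathcal A}(q)=\{w\in\Sigma^*\mid \delta^*(q,w)\in F\}$ and $L(\mathcal A)=L_{\mathcal A}(q_0)$. The automaton $\mathcal A$ is minimal if $L_{\mathcal A}(p)=L_{\mathcal A}(q)$ implies $p=q$ for all $p,q\in Q$. A characterization set for $\mathcal A$ is an equivariant set $W\subseteq\Sigma^*$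 with $\epsilon\in W$ such that, for all $p,q\in Q$, $L_{\mathcal A}(p)\cap W=L_{\mathcal A}(q)\cap W$ implies $L_{\mathcal A}(p)=L_{\mathcal A}(q)$. For a nominal set $C$ and an equivariant map $c\colon C\to\Sigma^*$, the fault domain $\mathcal U_c$ consists of all nominal automata $\mathcal I$ over $\Sigma$ (orbit-finite or not), with initial state $i_0$ and extended transition map $\delta_{\mathcal I}^*$, for which $c$ extends to a weak state cover. This means that there is an equivariant element $e\in C$ with $c(e)=\epsilon$, and there is an equivariant map $\delta_C\colon C\times\Sigma\to C$ such that $\delta_{\mathcal I}^*(i_0,c(\delta_C(x,a)))=\delta_{\mathcal I}^*(i_0,c(x)\,a)$ for all $x\in C$ and $a\in\Sigma$. For an equivariant set $P\subseteq\Sigma^*$ with inclusion $p\colon P\to\Sigma^*$ and for $k\in\mathbb N$, let $\mathcal U_p^k=\mathcal U_c$ for the map $c\colon P\times\Sigma^{\le k}\to\Sigma^*$, $c(u,v)=uv$. Let $\mathcal S$ be a minimal DNA over $\Sigma$. Then for every equivariant $P\subseteq\Sigma^*$ with inclusion $p$, every characterization set $W\subseteq\Sigma^*$ for $\mathcal S$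 and every $k\in\mathbb N$, the test suite $T=P\cdot\Sigma^{\le k+1}\cdot W$ is complete for $\mathcal S$ with respect to $\mathcal U_p^k$: for every $\mathcal I\in\mathcal U_p^k$, if $L(\mathcal S)\cap T=L(\mathcal I)\cap T$, then $L(\mathcal S)=L(\mathcal I)$. -/

import Mathlib

universe u v w w'

/-! ### Nominal sets -/

/-- The group `Perm(𝔸)` of finite permutations of the atoms, as a subgroup of all permutations. -/
def finPermSubgroup (𝔸 : Type u) : Subgroup (Equiv.Perm 𝔸) where
  carrier := {π | {a | π a ≠ a}.Finite}
  one_mem' := by simp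
  mul_mem' := by
    intro π ρ hπ hρ
    refine (Set.Finite.union hπ hρ).subset ?_
    intro a ha
    by_contra h
    simp only [Set.mem_union, Set.mem_ofPred_eq, not_or, not_not] at h
    exact ha (by rw [Equiv.Perm.mul_apply, h.2, h.1])
  inv_mem' := by
    intro π hπ
    refine Set.Finite.subset hπ ?_
    intro a ha h
    exact ha (by rw [Equiv.Perm.inv_eq_iff_eq]; exact h.symm)

/-- The group `Perm(𝔸)` of finite permutations of the atoms. It acts on `𝔸` by `π • a = π a`. -/
abbrev FinPerm (𝔸 : Type u) : Type u := ↥(finPermSubgroup 𝔸)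

/-- A `Perm(𝔸)`-set is nominal if every element is supported by a finite set of atoms. -/
class IsNominal (𝔸 : Type u) (X : Type v) [MulAction (FinPerm 𝔸) X] : Prop where
  exists_finite_support :
    ∀ x : X, ∃ s : Set 𝔸, s.Finite ∧ MulAction.Supports (FinPerm 𝔸) s x

/-- A `Perm(𝔸)`-set is orbit-finite if it has finitely many orbits. -/
class IsOrbitFinite (𝔸 : Type u) (X : Type v) [MulAction (FinPerm 𝔸) X] : Prop where
  finite_orbits : Finite (MulAction.orbitRel.Quotient (FinPerm 𝔸) X)

/-- The product of nominal sets (with the diagonal action) is nominal. -/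
instance IsNominal.prod (𝔸 : Type u) (X : Type v) (Y : Type w) [MulAction (FinPerm 𝔸) X]
    [MulAction (FinPerm 𝔸) Y] [IsNominal 𝔸 X] [IsNominal 𝔸 Y] : IsNominal 𝔸 (X × Y) where
  exists_finite_support := by
    rintro ⟨x, y⟩
    obtain ⟨s, hs, hx⟩ := IsNominal.exists_finite_support (𝔸 := 𝔸) x
    obtain ⟨t, ht, hy⟩ := IsNominal.exists_finite_support (𝔸 := 𝔸) y
    refine ⟨s ∪ t, hs.union ht, fun π hπ => ?_⟩
    exact Prod.ext (hx π fun a ha => hπ (Or.inl ha)) (hy π fun a ha => hπ (Or.inr ha))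

/-- An equivariant subset of a nominal set is nominal. -/
instance IsNominal.subset (𝔸 : Type u) (X : Type v) [MulAction (FinPerm 𝔸) X] [IsNominal 𝔸 X]
    (A : SubMulAction (FinPerm 𝔸) X) : IsNominal 𝔸 A where
  exists_finite_support := by
    intro x
    obtain ⟨s, hs, hx⟩ := IsNominal.exists_finite_support (𝔸 := 𝔸) (x : X)
    exact ⟨s, hs, fun π hπ => Subtype.ext (hx π hπ)⟩

/-! ### Words -/

/-- The pointwise action of `Perm(𝔸)` on words. -/
instance FinPerm.listMulAction (𝔸 : Type u) (α : Type v) [MulAction (FinPerm 𝔸) α] :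
    MulAction (FinPerm 𝔸) (List α) where
  smul π w := w.map fun a => π • a
  one_smul w := by
    change w.map (fun a => (1 : FinPerm 𝔸) • a) = w
    simp
  mul_smul π ρ w := by
    change w.map (fun a => (π * ρ) • a) = (w.map fun a => ρ • a).map fun a => π • a
    simp [mul_smul]

theorem FinPerm.smul_list {𝔸 : Type u} {α : Type v} [MulAction (FinPerm 𝔸) α]
    (π : FinPerm 𝔸) (w : List α) : π • w = w.map fun a => π • a := rfl

/-- Words over a nominal alphabet form a nominal set. -/
instance IsNominal.list (𝔸 : Type u) (α : Type v) [MulAction (FinPerm 𝔸) α] [IsNominal 𝔸 α] :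
    IsNominal 𝔸 (List α) where
  exists_finite_support := by
    intro w
    induction w with
    | nil => exact ⟨∅, Set.finite_empty, fun _ _ => rfl⟩
    | cons a w ih =>
      obtain ⟨s, hs, hw⟩ := ih
      obtain ⟨t, ht, ha⟩ := IsNominal.exists_finite_support (𝔸 := 𝔸) a
      refine ⟨t ∪ s, ht.union hs, fun π hπ => ?_⟩
      have h1 : π • a = a := ha π fun b hb => hπ (Or.inl hb)
      have h2 : π • w = w := hw π fun b hb => hπ (Or.inr hb)
      rw [FinPerm.smul_list] at h2 ⊢
      rw [List.map_cons, h1, h2]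

/-- An equivariant set of words over `α`, that is, a subset of `α*` closed under the action. -/
abbrev NomLanguage (𝔸 : Type u) (α : Type v) [MulAction (FinPerm 𝔸) α] : Type v :=
  SubMulAction (FinPerm 𝔸) (List α)

/-- The underlying set of words of an equivariant set of words. -/
def NomLanguage.toLanguage {𝔸 : Type u} {α : Type v} [MulAction (FinPerm 𝔸) α]
    (L : NomLanguage 𝔸 α) : Language α := {x | x ∈ L}

/-- The equivariant set `α^{≤k}` of words of length at most `k`. -/
def wordsLE (𝔸 : Type u) (α : Type v) [MulAction (FinPerm 𝔸) α] (k : ℕ) : NomLanguage 𝔸 α where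
  carrier := {x | x.length ≤ k}
  smul_mem' := by
    intro π x hx
    simpa [FinPerm.smul_list] using hx

/-- The concatenation `K · L = {x ++ y | x ∈ K, y ∈ L}` of equivariant sets of words
(`*` is Mathlib's concatenation of languages). -/
def NomLanguage.concat {𝔸 : Type u} {α : Type v} [MulAction (FinPerm 𝔸) α]
    (K L : NomLanguage 𝔸 α) : NomLanguage 𝔸 α where
  carrier := (K.toLanguage * L.toLanguage : Language α)
  smul_mem' := by
    rintro π _ ⟨x, hx, y, hy, rfl⟩
    exact ⟨π • x, K.smul_mem π hx, π • y, L.smul_mem π hy,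
      by simp [FinPerm.smul_list]⟩

/-- The concatenation `a · b : X × Y → α*`, `(x, y) ↦ a x ++ b y`, of two equivariant maps into
the set of words. -/
def concatHom {𝔸 : Type u} {α : Type v} [MulAction (FinPerm 𝔸) α] {X : Type*} {Y : Type*}
    [MulAction (FinPerm 𝔸) X] [MulAction (FinPerm 𝔸) Y]
    (a : X →[FinPerm 𝔸] List α) (b : Y →[FinPerm 𝔸] List α) : X × Y →[FinPerm 𝔸] List α where
  toFun z := a z.1 ++ b z.2
  map_smul' := by
    rintro π ⟨x, y⟩
    simp [FinPerm.smul_list]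

/-! ### Nominal automata -/

/-- A nominal automaton over the alphabet `α`: an automaton in the category of nominal sets and
equivariant maps (with cartesian product, and the discrete two-element output object). The
structure `toDFA` consists of the transition map, the initial state and the set of final states;
Mathlib's `DFA` imposes no finiteness on the set of states. -/
structure NominalAutomaton (𝔸 : Type u) (α : Type v) [MulAction (FinPerm 𝔸) α] where
  /-- The nominal set of states. -/
  State : Type w
  [action : MulAction (FinPerm 𝔸) State]
  [nominal : IsNominal 𝔸 State]
  /-- The transition map, initial state, and set of final states. -/
  toDFA : DFA α State
  smul_start : ∀ π : FinPerm 𝔸, π • toDFA.start = toDFA.start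
  smul_step : ∀ (π : FinPerm 𝔸) (q : State) (a : α),
    toDFA.step (π • q) (π • a) = π • toDFA.step q a
  smul_accept : ∀ (π : FinPerm 𝔸) (q : State), q ∈ toDFA.accept → π • q ∈ toDFA.accept

attribute [instance] NominalAutomaton.action NominalAutomaton.nominal

namespace NominalAutomaton

/-- Deterministic nominal automata (DNAs) are the nominal automata whose nominal set of states is
orbit-finite. -/
def IsDNA {𝔸 : Type u} {α : Type v} [MulAction (FinPerm 𝔸) α] (A : NominalAutomaton 𝔸 α) : Prop :=
  IsOrbitFinite 𝔸 A.State

/-- The language `⟦q⟧` accepted from the state `q`. -/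
def langFrom {𝔸 : Type u} {α : Type v} [MulAction (FinPerm 𝔸) α] (A : NominalAutomaton 𝔸 α)
    (q : A.State) : Language α := A.toDFA.acceptsFrom q

/-- The language accepted by `A`. -/
def lang {𝔸 : Type u} {α : Type v} [MulAction (FinPerm 𝔸) α] (A : NominalAutomaton 𝔸 α) :
    Language α := A.langFrom A.toDFA.start

/-- `A` is minimal if distinct states accept distinct languages. -/
def IsMinimal {𝔸 : Type u} {α : Type v} [MulAction (FinPerm 𝔸) α] (A : NominalAutomaton 𝔸 α) :
    Prop := ∀ p q : A.State, A.langFrom p = A.langFrom q → p = q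

/-- Two automata are equivalent if they accept the same language. -/
def Equivalent {𝔸 : Type u} {α : Type v} [MulAction (FinPerm 𝔸) α] (A : NominalAutomaton.{u, v, w} 𝔸 α)
    (B : NominalAutomaton.{u, v, w'} 𝔸 α) : Prop := A.lang = B.lang

/-- Two automata agree on the test suite `T` if their languages coincide on `T`. -/
def AgreeOn {𝔸 : Type u} {α : Type v} [MulAction (FinPerm 𝔸) α] (T : NomLanguage 𝔸 α)
    (A : NominalAutomaton.{u, v, w} 𝔸 α) (B : NominalAutomaton.{u, v, w'} 𝔸 α) : Prop :=
  A.lang ⊓ T.toLanguage = B.lang ⊓ T.toLanguage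

/-- `W` is a characterization set for `A` if it contains the empty word and states of `A` whose
accepted languages coincide on `W` accept the same language. -/
def IsCharacterizationSet {𝔸 : Type u} {α : Type v} [MulAction (FinPerm 𝔸) α]
    (A : NominalAutomaton 𝔸 α) (W : NomLanguage 𝔸 α) : Prop :=
  [] ∈ W ∧ ∀ p q : A.State,
    A.langFrom p ⊓ W.toLanguage = A.langFrom q ⊓ W.toLanguage → A.langFrom p = A.langFrom q

/-- The test suite `T` is complete for `S` with respect to the fault domain `U`. -/
def IsComplete {𝔸 : Type u} {α : Type v} [MulAction (FinPerm 𝔸) α]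
    (T : NomLanguage 𝔸 α) (S : NominalAutomaton.{u, v, w} 𝔸 α)
    (U : Set (NominalAutomaton.{u, v, w'} 𝔸 α)) : Prop :=
  ∀ I ∈ U, AgreeOn T S I → Equivalent S I

/-- The equivariant map `c : C → α*` together with the equivariant map `δ : C × α → C` is a weak
state cover for `A`: the empty word factors through `c` by an equivariant element of `C`, and for
all `x ∈ C` and `a ∈ α`, the words `c (δ (x, a))` and `c x ++ [a]` lead to the same state. -/
def IsWeakStateCover {𝔸 : Type u} {α : Type v} [MulAction (FinPerm 𝔸) α]
    (A : NominalAutomaton 𝔸 α) {C : Type*} [MulAction (FinPerm 𝔸) C] [IsNominal 𝔸 C]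
    (c : C →[FinPerm 𝔸] List α) (δ : C × α →[FinPerm 𝔸] C) : Prop :=
  (∃ e : C, (∀ π : FinPerm 𝔸, π • e = e) ∧ c e = []) ∧
    ∀ (x : C) (a : α), A.toDFA.eval (c (δ (x, a))) = A.toDFA.eval (c x ++ [a])

/-- The fault domain `𝒰_c` of all automata for which `c` extends to a weak state cover. -/
def faultDomain {𝔸 : Type u} {α : Type v} [MulAction (FinPerm 𝔸) α]
    {C : Type*} [MulAction (FinPerm 𝔸) C] [IsNominal 𝔸 C] (c : C →[FinPerm 𝔸] List α) :
    Set (NominalAutomaton.{u, v, w} 𝔸 α) :=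
  {I | ∃ δ : C × α →[FinPerm 𝔸] C, I.IsWeakStateCover c δ}

/-- The fault domain `𝒰_p^k = 𝒰_{p · i_k}`, where `i_k` is the inclusion of `α^{≤k}` into `α*`. -/
def faultDomainOrder {𝔸 : Type u} {α : Type v} [MulAction (FinPerm 𝔸) α] [IsNominal 𝔸 α]
    {P : Type*} [MulAction (FinPerm 𝔸) P] [IsNominal 𝔸 P] (k : ℕ) (p : P →[FinPerm 𝔸] List α) :
    Set (NominalAutomaton.{u, v, w} 𝔸 α) :=
  faultDomain (concatHom p (wordsLE 𝔸 α k).subtype)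

end NominalAutomaton

/-- The W test suite `P · α^{≤k+1} · W` of order `k` associated to `P` and `W`. -/
def wTestSuite {𝔸 : Type u} {α : Type v} [MulAction (FinPerm 𝔸) α] (k : ℕ)
    (P W : NomLanguage 𝔸 α) : NomLanguage 𝔸 α :=
  (P.concat (wordsLE 𝔸 α (k + 1))).concat W

/-! Write `c` for concatenation on `P × α^{≤k}`. The map `δ` witnessing that `c` is a weak state
cover for `I` works for `S` too: `c (δ (x, a))` and `c x ++ [a]` reach the same state of `I`, so no
suffix from `W` separates them there; with these suffixes both become tests, so agreement carries
this over to `S`, where `W` and minimality identify the states reached. With one `δ` serving both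
automata, every word has a representative `c x` reaching the same state as the word in each of them
(`equivalent_of_common_cover`), and each `c x` is itself a test. -/

namespace NominalAutomaton

variable {𝔸 : Type u} {α : Type v} [MulAction (FinPerm 𝔸) α]

/-- Automata that agree on a test suite accept the same words of that test suite. -/
theorem AgreeOn.mem_lang_iff {T : NomLanguage 𝔸 α} {A : NominalAutomaton.{u, v, w} 𝔸 α}
    {B : NominalAutomaton.{u, v, w'} 𝔸 α} (h : AgreeOn T A B) {x : List α} (hx : x ∈ T) :
    x ∈ A.lang ↔ x ∈ B.lang := by
  have key : x ∈ A.lang ∧ x ∈ T ↔ x ∈ B.lang ∧ x ∈ T := Set.ext_iff.mp h x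
  simpa only [hx, and_true] using key

/-- The language of the state reached by `x` is the derivative of the accepted language at `x`. -/
theorem mem_langFrom_eval (A : NominalAutomaton.{u, v, w} 𝔸 α) (x y : List α) :
    y ∈ A.langFrom (A.toDFA.eval x) ↔ x ++ y ∈ A.lang := by
  change A.toDFA.evalFrom (A.toDFA.evalFrom A.toDFA.start x) y ∈ A.toDFA.accept ↔
    A.toDFA.evalFrom A.toDFA.start (x ++ y) ∈ A.toDFA.accept
  rw [DFA.evalFrom_of_append]

/-- If every word has a representative in `C` leading to the same state in both automata, and
the automata agree on the representatives, then the automata are equivalent. -/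
theorem equivalent_of_common_cover {A : NominalAutomaton.{u, v, w} 𝔸 α}
    {B : NominalAutomaton.{u, v, w'} 𝔸 α} {C : Type*} (c : C → List α)
    (hnil : ∃ e, c e = [])
    (hstep : ∀ x a, ∃ y, A.toDFA.eval (c y) = A.toDFA.eval (c x ++ [a]) ∧
      B.toDFA.eval (c y) = B.toDFA.eval (c x ++ [a]))
    (hagree : ∀ x, c x ∈ A.lang ↔ c x ∈ B.lang) : Equivalent A B := by
  have cover : ∀ z : List α, ∃ x, A.toDFA.eval (c x) = A.toDFA.eval z ∧
      B.toDFA.eval (c x) = B.toDFA.eval z := by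
    intro z
    -- Covers are extended by a letter on the right, hence induction from the right end; the same
    -- `x` has to serve both automata.
    induction z using List.reverseRecOn with
    | nil =>
      obtain ⟨e, he⟩ := hnil
      exact ⟨e, by rw [he], by rw [he]⟩
    | append_singleton z a ih =>
      obtain ⟨x, hA, hB⟩ := ih
      obtain ⟨y, hyA, hyB⟩ := hstep x a
      refine ⟨y, ?_, ?_⟩
      · rw [hyA, DFA.eval_append_singleton, DFA.eval_append_singleton, hA]
      · rw [hyB, DFA.eval_append_singleton, DFA.eval_append_singleton, hB]
  refine Set.ext fun z => ?_
  obtain ⟨x, hA, hB⟩ := cover z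
  change A.toDFA.eval z ∈ A.toDFA.accept ↔ B.toDFA.eval z ∈ B.toDFA.accept
  rw [← hA, ← hB]
  exact hagree x

end NominalAutomaton

/-- Words `u v y` with `u ∈ P`, `v` of length at most `k + 1` and `y ∈ W` are W tests. -/
theorem append_mem_wTestSuite {𝔸 : Type u} {α : Type v} [MulAction (FinPerm 𝔸) α] {k : ℕ}
    {P W : NomLanguage 𝔸 α} {x v y : List α} (hx : x ∈ P) (hv : v.length ≤ k + 1) (hy : y ∈ W) :
    x ++ v ++ y ∈ wTestSuite k P W :=
  ⟨x ++ v, ⟨x, hx, v, hv, rfl⟩, y, hy, rfl⟩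

theorem mainTheorem5 {𝔸 : Type u} [Countable 𝔸]
    {α : Type v} [MulAction (FinPerm 𝔸) α] [IsNominal 𝔸 α] [IsOrbitFinite 𝔸 α]
    (S : NominalAutomaton.{u, v, w} 𝔸 α) (hS : S.IsDNA) (hmin : S.IsMinimal)
    (P W : NomLanguage 𝔸 α) (hW : S.IsCharacterizationSet W) (k : ℕ) :
    NominalAutomaton.IsComplete (wTestSuite k P W) S
      (NominalAutomaton.faultDomainOrder.{u, v, w'} k P.subtype) := by
  rintro I ⟨δ, ⟨e, -, he⟩, hδ⟩ hagree
  have short (x : P × wordsLE 𝔸 α k) : (x.2 : List α).length ≤ k := x.2.2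
  have test (x : P × wordsLE 𝔸 α k) {y : List α} (hy : y ∈ W) :
      concatHom P.subtype (wordsLE 𝔸 α k).subtype x ++ y ∈ wTestSuite k P W :=
    append_mem_wTestSuite x.1.2 ((short x).trans k.le_succ) hy
  have test_step (x : P × wordsLE 𝔸 α k) (a : α) {y : List α} (hy : y ∈ W) :
      concatHom P.subtype (wordsLE 𝔸 α k).subtype x ++ [a] ++ y ∈ wTestSuite k P W := by
    -- The letter `a` is absorbed into the middle factor, which is why the suite needs length `k +
    -- 1` and not just `k`.
    have h : (x.1 : List α) ++ ((x.2 : List α) ++ [a]) ++ y ∈ wTestSuite k P W :=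
      append_mem_wTestSuite x.1.2 (by simpa using short x) hy
    rwa [← List.append_assoc] at h
  refine NominalAutomaton.equivalent_of_common_cover
    (concatHom P.subtype (wordsLE 𝔸 α k).subtype) ⟨e, he⟩ (fun x a => ⟨δ (x, a), ?_, hδ x a⟩)
    fun x => ?_
  -- In `S`, equality of states reduces to acceptance of the same suffixes `y ∈ W`.
  · refine hmin _ _ (hW.2 _ _ (Set.ext fun y => and_congr_left fun hy => ?_))
    refine (S.mem_langFrom_eval _ _).trans (Iff.trans ?_ (S.mem_langFrom_eval _ _).symm)
    -- Both membership questions move from `S` to `I`, where `hδ` makes the two states equal.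
    rw [hagree.mem_lang_iff (test _ hy), hagree.mem_lang_iff (test_step x a hy),
      ← I.mem_langFrom_eval, ← I.mem_langFrom_eval, hδ x a]
  -- The empty suffix lies in `W`, so `c x` is a test.
  · exact hagree.mem_lang_iff (by simpa using test x hW.1)
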